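/- For integers $k, n \ge 1$ let $\sigma_k(n) = \sum_{d \mid n} d^k$ be the sum of the $k$-th powers of the positive divisors of $n$, and write $\sigma = \sigma_1$. Let $\tau(n)$ be Ramanujan's tau function, defined by $$\Delta = q\prod_{m\ge 1}(1-q^m)^{24} = \sum_{n\ge 1}\tau(n)q^n.$$ Then for every integer $n \ge 1$ the following eight congruences hold: $$ \begin{aligned} \text{(i)}\quad & 12\,\tau(n) \equiv 5n\sigma_3(n) + 7n\sigma_5(n) && \pmod{2^3\cdot 3\cdot 5\cdot 7},\\ \text{(ii)}\quad & 32\,\tau(n) \equiv 15n\sigma(n) + 50n^2\sigma_7(n) - 33n\sigma_9(n) && \pmod{2^5\cdot 3^2\cdot 5^2},\\ \text{(iii)}\quad & 7\,\tau(n) \equiv 6n^2\sigma(n) - 9n^3\sigma_5(n) + 10n^2\sigma_7(n) && \pmod{2^4\cdot 3^3\cdot 7},\\ \text{(iv)}\quad & 5\,\tau(n) \equiv 14n^3\sigma(n) + 12n^4\sigma_3(n) - 21n^3\sigma_5(n) && \pmod{2^5\cdot 3\cdot 5\cdot 7},\\ \text{(v)}\quad & 24\,\tau(n) \equiv 10n\sigma(n)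 + 25n\sigma_7(n) - 11n\sigma_9(n) && \pmod{2^3\cdot 3\cdot 5^2},\\ \text{(vi)}\quad & 14\,\tau(n) \equiv 9n^2\sigma(n) + 5n^2\sigma_7(n) && \pmod{2^3\cdot 3^3\cdot 7},\\ \text{(vii)}\quad & 5\,\tau(n) \equiv 8n^3\sigma(n) - 3n^3\sigma_5(n) && \pmod{2^5\cdot 3\cdot 5},\\ \text{(viii)}\quad & 2\,\tau(n) \equiv n^2\sigma(n) + n^2\sigma_5(n) && \pmod{2^3\cdot 3}. \end{aligned} $$ -/

import Mathlib

open scoped ArithmeticFunction.sigma PowerSeries.WithPiTopology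

/-- The infinite product defining `ramanujanTau` converges in `ℤ⟦q⟧` (coefficientwise), so that
the `∏'` there is the genuine product and not a default value. -/
theorem multipliable_ramanujanTau_factors :
    Multipliable fun m : ℕ ↦ ((1 : PowerSeries ℤ) - PowerSeries.X ^ (m + 1)) ^ 24 :=
  (PowerSeries.WithPiTopology.multipliable_one_sub_X_pow ℤ).pow 24

/-- Ramanujan's tau function: `τ(n)` is the coefficient of `q ^ n` in
`Δ = q * ∏_{m ≥ 1} (1 - q ^ m) ^ 24`, an identity of power series in `q` with integer
coefficients. -/
noncomputable def ramanujanTau (n : ℕ) : ℤ :=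
  PowerSeries.coeff n
    (PowerSeries.X * ∏' m : ℕ, ((1 : PowerSeries ℤ) - PowerSeries.X ^ (m + 1)) ^ 24)

/-! Let `θ = q d/dq` and let `P`, `Q`, `R` be the Eisenstein series of weights 2, 4, 6. By
Ramanujan's differential equations, `θ` acts on polynomials in `P`, `Q`, `R`, and `1728 Δ = Q³ -
R²`. For each congruence there is a weight 12 combination of derivatives, and of products with a
differentiated factor, in which every monomial containing `P` cancels and a multiple of `Q³ - R²`
remains (the `mul_delta_*` lemmas). Substituting `1 + a ∑ σ_k(n) qⁿ` for each Eisenstein series, the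
linear terms give the divisor sums, with `θ` supplying the powers of `n`. The quadratic terms are,
after division by a common factor, divisible by the modulus.

The differential equations come from modularity: a level one form of weight below 12 is determined
by its constant term (`HasQSeries.eq_of_weight_lt_twelve`), and Serre derivatives of Eisenstein
series are such forms. The formula for `Δ` follows from `θ Δ = Δ P`, the logarithmic derivative of
the product, because this equation has at most one solution with given coefficients of `1` and `q`
(`eq_zero_of_eulerDerivation_eq_mul`). -/

/-! ### The Euler derivation on formal power series. -/

section EulerDerivative

open PowerSeries

/-- The Euler derivation `X * d/dX` on formal power series. -/
noncomputable def PowerSeries.eulerDerivation (R : Type*) [CommRing R] : Derivation R R⟦X⟧ R⟦X⟧ :=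
  (X : R⟦X⟧) • PowerSeries.derivative R

theorem PowerSeries.coeff_eulerDerivation {R : Type*} [CommRing R] (f : R⟦X⟧) (n : ℕ) :
    coeff n (eulerDerivation R f) = n * coeff n f := by
  cases n with
  | zero => simp [eulerDerivation]
  | succ n => simp [eulerDerivation, coeff_succ_X_mul, coeff_derivative, mul_comm]

theorem PowerSeries.map_eulerDerivation {R S : Type*} [CommRing R] [CommRing S] (φ : R →+* S)
    (f : R⟦X⟧) : map φ (eulerDerivation R f) = eulerDerivation S (map φ f) := by
  ext n
  simp [coeff_eulerDerivation]

end EulerDerivative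

/-! ### Functions on the upper half plane with convergent q-series. -/

section QSeries

open UpperHalfPlane hiding I
open Complex Real Function PowerSeries ModularForm Derivative
open scoped Manifold MatrixGroups Topology

local notation "𝕢" => Periodic.qParam

/-- `f` is given on the upper half plane by the convergent `q`-series with coefficients `c`. -/
def HasQSeries (f : ℍ → ℂ) (c : ℂ⟦X⟧) : Prop :=
  ∀ τ : ℍ, HasSum (fun m ↦ coeff m c * 𝕢 1 τ ^ m) (f τ)

namespace HasQSeries

variable {f g : ℍ → ℂ} {c d : ℂ⟦X⟧}

theorem add (hf : HasQSeries f c) (hg : HasQSeries g d) : HasQSeries (f + g) (c + d) := fun τ ↦ by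
  simpa [add_mul] using (hf τ).add (hg τ)

theorem sub (hf : HasQSeries f c) (hg : HasQSeries g d) : HasQSeries (f - g) (c - d) := fun τ ↦ by
  simpa [sub_mul] using (hf τ).sub (hg τ)

theorem smul (a : ℂ) (hf : HasQSeries f c) : HasQSeries (a • f) (a • c) := fun τ ↦ by
  simpa [mul_assoc] using (hf τ).mul_left a

theorem mul (hf : HasQSeries f c) (hg : HasQSeries g d) : HasQSeries (f * g) (c * d) := fun τ ↦ by
  have h := (summable_norm_sum_mul_antidiagonal_of_summable_norm (hf τ).summable.norm
    (hg τ).summable.norm).of_norm.hasSum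
  rw [← tsum_mul_tsum_eq_tsum_sum_antidiagonal_of_summable_norm (hf τ).summable.norm
    (hg τ).summable.norm, (hf τ).tsum_eq, (hg τ).tsum_eq] at h
  refine h.congr_fun fun m ↦ ?_
  rw [PowerSeries.coeff_mul, Finset.sum_mul]
  refine Finset.sum_congr rfl fun x hx ↦ ?_
  rw [← Finset.HasAntidiagonal.mem_antidiagonal.mp hx, pow_add]
  ring

/-- The map `τ ↦ 𝕢 1 τ` covers the punctured unit disc, and at `q = 0` only one term survives. -/
theorem hasSum_of_norm_lt_one (hf : HasQSeries f c) {q : ℂ} (hq : ‖q‖ < 1) :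
    HasSum (fun m ↦ coeff m c * q ^ m) (∑' m, coeff m c * q ^ m) := by
  rcases eq_or_ne q 0 with rfl | hq0
  · refine (summable_of_ne_finset_zero (s := {0}) fun m hm ↦ ?_).hasSum
    simp [show m ≠ 0 by simpa using hm]
  · have h := hf ⟨_, Periodic.im_invQParam_pos_of_norm_lt_one one_pos hq hq0⟩
    simp only [Periodic.qParam_right_inv one_ne_zero hq0] at h
    exact h.summable.hasSum

theorem hasFPowerSeriesOnBall (hf : HasQSeries f c) :
    HasFPowerSeriesOnBall (fun q : ℂ ↦ ∑' m, coeff m c * q ^ m)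
      (.ofScalars ℂ fun m ↦ coeff m c) 0 1 := by
  constructor
  · refine le_of_forall_lt_imp_le_of_dense fun r hr ↦ ?_
    lift r to NNReal using hr.ne_top
    apply FormalMultilinearSeries.le_radius_of_summable
    simpa [mul_comm, mul_left_comm, mul_assoc] using
      (hf.hasSum_of_norm_lt_one (q := r) (by simpa using hr)).summable.norm
  · simp
  · intro y hy
    rw [← ENNReal.coe_one, Metric.eball_coe, NNReal.coe_one, mem_ball_zero_iff] at hy
    simpa [mul_comm] using hf.hasSum_of_norm_lt_one hy

/-- Zeros of a nonzero analytic function are isolated, whereas this sum vanishes on the whole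
punctured disc. -/
theorem eq_zero (hf : HasQSeries 0 c) : c = 0 := by
  by_contra hc
  have hp : FormalMultilinearSeries.ofScalars ℂ (fun m ↦ coeff m c) ≠ 0 := fun h ↦ hc <| by
    ext m
    have h' := congr_arg (fun p : FormalMultilinearSeries ℂ ℂ ℂ ↦ p.coeff m) h
    simp only [FormalMultilinearSeries.coeff_ofScalars] at h'
    rw [h', FormalMultilinearSeries.coeff]
    simp
  have h1 := hf.hasFPowerSeriesOnBall.hasFPowerSeriesAt.locally_ne_zero hp
  have h2 : ∀ᶠ q : ℂ in 𝓝[≠] 0, q ∈ Metric.ball (0 : ℂ) 1 ∧ q ≠ 0 :=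
    (eventually_nhdsWithin_of_eventually_nhds (Metric.ball_mem_nhds 0 one_pos)).and
      self_mem_nhdsWithin
  obtain ⟨q, hq, hq1, hq0⟩ := (h1.and h2).exists
  rw [mem_ball_zero_iff] at hq1
  have h := hf ⟨_, Periodic.im_invQParam_pos_of_norm_lt_one one_pos hq1 hq0⟩
  simp only [Periodic.qParam_right_inv one_ne_zero hq0] at h
  exact hq h.tsum_eq

theorem unique (hc : HasQSeries f c) (hd : HasQSeries f d) : c = d :=
  sub_eq_zero.mp (eq_zero (by simpa using hc.sub hd))

/-- By the chain rule `(2πi)⁻¹ d/dτ` is `q d/dq`; the Taylor series of `F'` then supplies the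
coefficients. -/
theorem normalizedDeriv (hf : HasQSeries f c) :
    HasQSeries (normalizedDerivOfComplex f) (eulerDerivation ℂ c) := by
  intro τ
  set F : ℂ → ℂ := fun q ↦ ∑' m, coeff m c * q ^ m with hF
  have hFd : DifferentiableOn ℂ F (Metric.ball 0 1) := by
    have := hf.hasFPowerSeriesOnBall.differentiableOn
    rwa [← ENNReal.coe_one, Metric.eball_coe, NNReal.coe_one] at this
  have hcoeff (m : ℕ) : coeff m c = (m.factorial : ℂ)⁻¹ * iteratedDeriv m F 0 := by
    have h := (hFd.analyticAt (Metric.ball_mem_nhds 0 one_pos)).hasFPowerSeriesAt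
    have := congr_arg (fun p : FormalMultilinearSeries ℂ ℂ ℂ ↦ p.coeff m)
      (hf.hasFPowerSeriesOnBall.hasFPowerSeriesAt.eq_formalMultilinearSeries h)
    simpa only [FormalMultilinearSeries.coeff_ofScalars, div_eq_inv_mul] using this
  have hq : ‖𝕢 1 τ‖ < 1 := Periodic.norm_qParam_lt_one one_pos τ.im_pos
  have hqb : 𝕢 1 τ ∈ Metric.ball (0 : ℂ) 1 := by simpa using hq
  have hder : normalizedDerivOfComplex f τ = 𝕢 1 τ * deriv F (𝕢 1 τ) := by
    have h1 : HasDerivAt F (deriv F (𝕢 1 τ)) (𝕢 1 τ) :=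
      (hFd.differentiableAt (Metric.isOpen_ball.mem_nhds hqb)).hasDerivAt
    have h2 : HasDerivAt (𝕢 1) (2 * π * I * 𝕢 1 τ) (τ : ℂ) := by
      have h := ((hasDerivAt_id (τ : ℂ)).const_mul (2 * π * I)).cexp
      have e : 𝕢 1 = fun z : ℂ ↦ cexp (2 * π * I * id z) := by
        ext z
        simp [Periodic.qParam]
      simpa [e, mul_comm, mul_left_comm] using h
    have h3 : f ∘ ofComplex =ᶠ[𝓝 (τ : ℂ)] F ∘ 𝕢 1 := by
      filter_upwards [isOpen_upperHalfPlaneSet.mem_nhds τ.2] with z hz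
      simp only [comp_apply, ofComplex_apply_of_im_pos hz]
      exact ((hf ⟨z, hz⟩).tsum_eq).symm
    rw [normalizedDerivOfComplex, h3.deriv_eq, (h1.comp (τ : ℂ) h2).deriv]
    field_simp
  have hsum := (hasSum_taylorSeries_on_ball (hFd.deriv Metric.isOpen_ball) 
    (by simpa using hq : 𝕢 1 τ ∈ Metric.ball (0 : ℂ) ((1 : NNReal) : ℝ))).mul_left (𝕢 1 τ)
  rw [← hder] at hsum
  -- The factor `q` in front of `F'` shifts indices by one; the term of index `0` is zero.
  rw [← hasSum_nat_add_iff' 1]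
  simp only [coeff_eulerDerivation, Finset.range_one, Finset.sum_singleton, Nat.cast_zero,
    zero_mul, sub_zero]
  refine hsum.congr_fun fun m ↦ ?_
  rw [hcoeff (m + 1), iteratedDeriv_succ', Nat.factorial_succ]
  have h1 : (m.factorial : ℂ) ≠ 0 := mod_cast m.factorial_ne_zero
  have h2 : (m + 1 : ℂ) ≠ 0 := mod_cast m.succ_ne_zero
  push_cast
  simp only [smul_eq_mul, sub_zero]
  field_simp
  ring

end HasQSeries

end QSeries

/-! ### Level one modular forms, Eisenstein series and Serre derivatives. -/

section LevelOne

open UpperHalfPlane hiding I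
open Complex Real Function PowerSeries ModularForm Derivative EisensteinSeries
open scoped Manifold MatrixGroups Topology

/-- A holomorphic function on the upper half plane with a `q`-series that is weight `k` invariant
under `SL(2, ℤ)`, as a modular form. -/
noncomputable def HasQSeries.toModularForm {f : ℍ → ℂ} {c : ℂ⟦X⟧} (hf : HasQSeries f c)
    (hol : MDiff f) {k : ℤ} (hk : ∀ γ : SL(2, ℤ), f ∣[k] γ = f) : ModularForm 𝒮ℒ k where
  toFun := f
  slash_action_eq' A hA := by
    obtain ⟨A, rfl⟩ := hA
    exact hk A
  holo' := hol
  bdd_at_cusps' hc := by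
    rw [Subgroup.IsArithmetic.isCusp_iff_isCusp_SL2Z] at hc
    rw [OnePoint.isBoundedAt_iff_forall_SL2Z hc]
    intro γ _
    rw [hk]
    exact isBoundedAtImInfty_of_hasSum_qExpansion one_pos hf

theorem ModularForm.hasQSeries_qExpansion {k : ℤ} (f : ModularForm 𝒮ℒ k) :
    HasQSeries f (qExpansion 1 f) :=
  fun τ ↦ ModularForm.hasSum_qExpansion f one_pos one_mem_strictPeriods_SL τ

/-- A modular form of level one and weight less than `12` whose `q`-series has vanishing
constant coefficient is zero. -/
theorem HasQSeries.eq_zero_of_weight_lt_twelve {f : ℍ → ℂ} {c : ℂ⟦X⟧} (hf : HasQSeries f c)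
    (hol : MDiff f) {k : ℕ} (hk : ∀ γ : SL(2, ℤ), f ∣[(k : ℤ)] γ = f) (hk12 : k < 12)
    (hc : constantCoeff c = 0) : c = 0 := by
  have hq : qExpansion 1 (hf.toModularForm hol hk) = c :=
    (ModularForm.hasQSeries_qExpansion _).unique hf
  have h0 : hf.toModularForm hol hk = 0 := by
    -- The Sturm bound is `⌊k / 12⌋ = 0`, so order at least one suffices.
    refine ModularForm.sturm_bound_levelOne_nat ?_
    rw [hq, Nat.div_eq_of_lt hk12, Nat.cast_zero, pos_iff_ne_zero]
    exact order_ne_zero_iff_constCoeff_eq_zero.mpr hc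
  refine HasQSeries.eq_zero (?_ : HasQSeries 0 c)
  rwa [show f = 0 from congr_arg DFunLike.coe h0] at hf

theorem EisensteinSeries.E_slash {k : ℕ} (hk : 3 ≤ k) (γ : SL(2, ℤ)) :
    (E hk : ℍ → ℂ) ∣[(k : ℤ)] γ = E hk :=
  (E hk).slash_action_eq' _ ⟨γ, rfl⟩

/-- The series `∑ σ k n * X ^ n`. -/
noncomputable def sigmaSeries (k : ℕ) : ℤ⟦X⟧ := PowerSeries.mk fun n ↦ (σ k n : ℤ)

@[simp]
theorem coeff_sigmaSeries (k n : ℕ) : coeff n (sigmaSeries k) = (σ k n : ℤ) := coeff_mk _ _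

/-- The normalised Eisenstein series `1 + a * ∑ σ k n * X ^ n` of weight `k + 1`, where the
normalising integer `a` is a parameter. -/
noncomputable def eisensteinPowerSeries (a : ℤ) (k : ℕ) : ℤ⟦X⟧ := 1 + a • sigmaSeries k

theorem coeff_eisensteinPowerSeries (a : ℤ) (k n : ℕ) :
    coeff n (eisensteinPowerSeries a k) = if n = 0 then 1 else a * (σ k n : ℤ) := by
  rw [eisensteinPowerSeries, map_add, coeff_one, map_zsmul, coeff_sigmaSeries]
  split_ifs with hn <;> simp [hn]

/-- The hypothesis `ha` is `a = -2k / B_k` with the denominator cleared; it also forces `B_k ≠ 0`.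
-/
theorem EisensteinSeries.hasQSeries_E {k : ℕ} (hk : 3 ≤ k) (hk2 : Even k) {a : ℤ}
    (ha : a * bernoulli k = -(2 * k)) :
    HasQSeries (E hk) (map (Int.castRingHom ℂ) (eisensteinPowerSeries a (k - 1))) := by
  have h := ModularForm.hasQSeries_qExpansion (E hk)
  convert h using 1
  ext n
  have hb : (bernoulli k : ℂ) ≠ 0 := by
    rintro hb
    have : bernoulli k = 0 := by exact_mod_cast hb
    rw [this] at ha
    have : (k : ℚ) = 0 := by linarith
    norm_cast at this
    omega
  have ha' : (a : ℂ) * bernoulli k = -(2 * k) := by exact_mod_cast congr_arg (Rat.cast : ℚ → ℂ) ha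
  rw [coeff_map, coeff_eisensteinPowerSeries, EisensteinSeries.E_qExpansion_coeff hk hk2]
  split_ifs
  · simp
  · rw [← neg_div, ← ha', mul_div_cancel_right₀ _ hb]
    simp

theorem EisensteinSeries.hasQSeries_E2 :
    HasQSeries E2 (map (Int.castRingHom ℂ) (eisensteinPowerSeries (-24) 1)) := fun τ ↦ by
  have h := hasSum_qExpansion_E2 (z := τ)
  refine h.congr_fun fun m ↦ ?_
  rw [coeff_map, coeff_eisensteinPowerSeries]
  simp [Periodic.qParam]

theorem Derivative.serreDerivative_hasQSeries {f : ℍ → ℂ} {c : ℂ⟦X⟧} (k : ℂ)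
    (hf : HasQSeries f c) :
    HasQSeries (serreDerivative k f) (eulerDerivation ℂ c - (k * 12⁻¹) •
      (map (Int.castRingHom ℂ) (eisensteinPowerSeries (-24) 1) * c)) := by
  convert hf.normalizedDeriv.sub ((hasQSeries_E2.mul hf).smul (k * 12⁻¹)) using 1
  ext z
  simp [mul_assoc]

theorem EisensteinSeries.hasDerivAt_D2 (γ : SL(2, ℤ)) (z : ℍ) :
    HasDerivAt (D2 γ ∘ ofComplex) (-(2 * π * I) * (γ 1 0 / denom γ z) ^ 2) (z : ℂ) := by
  have h := (hasDerivAt_denom_zpow (γ : GL (Fin 2) ℝ) (-1) z).const_mul (2 * π * I * (γ 1 0 : ℂ))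
  refine (h.congr_of_eventuallyEq ?_).congr_deriv ?_
  · filter_upwards [isOpen_upperHalfPlaneSet.mem_nhds z.im_pos] with w hw
    simp [D2, ofComplex_apply_of_im_pos hw, div_eq_mul_inv]
  · have hz := denom_ne_zero (γ : GL (Fin 2) ℝ) z
    norm_num [zpow_neg]
    field_simp

/-- The Serre derivative of `E2`, with weight `1` in place of `2`, is invariant of weight `4`. -/
theorem Derivative.serreDerivative_one_E2_slash (γ : SL(2, ℤ)) :
    serreDerivative 1 E2 ∣[(4 : ℤ)] γ = serreDerivative 1 E2 := by
  have hD2 : MDiff (D2 γ) := fun z ↦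
    UpperHalfPlane.mdifferentiableAt_iff.mpr (hasDerivAt_D2 γ z).differentiableAt
  have hD2' : MDiff ((1 / (2 * riemannZeta 2)) • D2 γ) := hD2.const_smul _
  ext z
  have hLHS : (serreDerivative 1 E2 ∣[(4 : ℤ)] γ) z =
      (normalizedDerivOfComplex E2 ∣[(2 + 2 : ℤ)] γ) z -
        12⁻¹ * ((E2 ∣[(2 : ℤ)] γ) z * (E2 ∣[(2 : ℤ)] γ) z) := by
    have := congrFun (ModularForm.mul_slash_SL2 2 2 γ E2 E2) z
    grind [ModularForm.SL_slash_apply, serreDerivative_apply, Pi.mul_apply]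
  have hDz := congrFun (normalizedDerivOfComplex_SL_slash (k := 2) E2_mdifferentiable (γ := γ)) z
  have hE2z : (E2 ∣[(2 : ℤ)] γ) z = E2 z - 1 / (2 * riemannZeta 2) * D2 γ z := by
    simp [E2_slash_action]
  have hDD2 : normalizedDerivOfComplex (D2 γ) z = -(γ 1 0 / denom γ z) ^ 2 := by
    rw [normalizedDerivOfComplex, (hasDerivAt_D2 γ z).deriv]
    field_simp
  rw [E2_slash_action, normalizedDerivOfComplex_sub _ _ E2_mdifferentiable hD2',
    normalizedDerivOfComplex_smul _ _ hD2, ← E2_slash_action] at hDz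
  simp only [Pi.sub_apply, Pi.smul_apply, smul_eq_mul, hDD2] at hDz
  rw [hLHS, serreDerivative_apply]
  have hD2z : D2 γ z = 2 * π * I * (γ 1 0 / denom γ z) := by rw [D2, mul_div_assoc]
  rw [hD2z] at hE2z
  -- With `w = c / (cz + d)`, slashing changes both `D E2` and `E2² / 12` by `-(i/π) w E2 - (3/π²)
  -- w²`, so their difference is invariant.
  generalize ((γ 1 0 : ℂ) / denom γ z) = w at hDz hE2z
  have hπ : (π : ℂ) ≠ 0 := mod_cast Real.pi_ne_zero
  have hinv : (2 * π * I : ℂ)⁻¹ = -I * (π : ℂ)⁻¹ / 2 := by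
    rw [mul_inv, mul_inv, inv_I]
    ring
  have hζ : 1 / (2 * riemannZeta 2) = 3 * (π : ℂ)⁻¹ ^ 2 := by
    rw [riemannZeta_two]
    field_simp
    norm_num
  have hE : (E2 ∣[(2 : ℤ)] γ) z = E2 z - 6 * (π : ℂ)⁻¹ * I * w := by
    rw [hE2z, hζ]
    field_simp
    ring
  rw [hinv, hζ, hE] at hDz
  rw [hE]
  rw [Int.cast_ofNat] at hDz
  linear_combination -hDz + 3 * (π : ℂ)⁻¹ ^ 2 * w ^ 2 * I_sq

end LevelOne

/-! ### Identities between Eisenstein series and Ramanujan's differential equations. -/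

section Ramanujan

open UpperHalfPlane hiding I
open Complex Real Function PowerSeries ModularForm Derivative EisensteinSeries
open scoped Manifold MatrixGroups Topology

local notation "θ" => eulerDerivation ℤ
local notation "𝐏" => eisensteinPowerSeries (-24) 1
local notation "𝐐" => eisensteinPowerSeries 240 3
local notation "𝐑" => eisensteinPowerSeries (-504) 5
local notation "𝐒" => eisensteinPowerSeries 480 7
local notation "𝐓" => eisensteinPowerSeries (-264) 9

instance PowerSeries.instCharZero {R : Type*} [CommRing R] [CharZero R] : CharZero R⟦X⟧ :=
  charZero_of_injective_ringHom (C_injective (R := R))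

theorem constantCoeff_eisensteinPowerSeries (a : ℤ) (k : ℕ) :
    constantCoeff (eisensteinPowerSeries a k) = 1 := by
  simpa using coeff_eisensteinPowerSeries a k 0

theorem PowerSeries.constantCoeff_map_ringHom {R S : Type*} [CommRing R] [CommRing S]
    (φ : R →+* S) (f : R⟦X⟧) : constantCoeff (map φ f) = φ (constantCoeff f) := by
  rw [← coeff_zero_eq_constantCoeff_apply, ← coeff_zero_eq_constantCoeff_apply, coeff_map]

theorem PowerSeries.constantCoeff_eulerDerivation {R : Type*} [CommRing R] (f : R⟦X⟧) :
    constantCoeff (eulerDerivation R f) = 0 := by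
  simpa using coeff_eulerDerivation f 0

theorem HasQSeries.eq_of_weight_lt_twelve {f g : ℍ → ℂ} {c d : ℂ⟦X⟧} (hf : HasQSeries f c)
    (hg : HasQSeries g d) (holf : MDiff f) (holg : MDiff g) {k : ℕ}
    (hkf : ∀ γ : SL(2, ℤ), f ∣[(k : ℤ)] γ = f) (hkg : ∀ γ : SL(2, ℤ), g ∣[(k : ℤ)] γ = g)
    (hk12 : k < 12) (h : constantCoeff c = constantCoeff d) : c = d := by
  refine sub_eq_zero.mp ((hf.sub hg).eq_zero_of_weight_lt_twelve (holf.sub holg) (k := k)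
    (fun γ ↦ ?_) hk12 (by simp [h]))
  simp only [sub_eq_add_neg, SlashAction.add_slash, SL_slash, SlashAction.neg_slash]
  simp only [← SL_slash, hkf, hkg]

theorem PowerSeries.map_intCast_injective :
    Injective (map (Int.castRingHom ℂ) : ℤ⟦X⟧ → ℂ⟦X⟧) :=
  map_injective _ Int.cast_injective

theorem hasQSeries_E₄ : HasQSeries E₄ (map (Int.castRingHom ℂ) 𝐐) :=
  hasQSeries_E _ ⟨2, rfl⟩ (by norm_num [show bernoulli 4 = -1 / 30 by decide +kernel])

theorem hasQSeries_E₆ : HasQSeries E₆ (map (Int.castRingHom ℂ) 𝐑) :=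
  hasQSeries_E _ ⟨3, rfl⟩ (by norm_num [show bernoulli 6 = 1 / 42 by decide +kernel])

theorem hasQSeries_E₈ : HasQSeries (E (by norm_num : 3 ≤ 8)) (map (Int.castRingHom ℂ) 𝐒) :=
  hasQSeries_E _ ⟨4, rfl⟩ (by norm_num [show bernoulli 8 = -1 / 30 by decide +kernel])

theorem hasQSeries_E₁₀ : HasQSeries (E (by norm_num : 3 ≤ 10)) (map (Int.castRingHom ℂ) 𝐓) :=
  hasQSeries_E _ ⟨5, rfl⟩ (by norm_num [show bernoulli 10 = 5 / 66 by decide +kernel])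

theorem eisensteinPowerSeries_eight : 𝐒 = 𝐐 ^ 2 := by
  refine map_intCast_injective ?_
  rw [map_pow, pow_two]
  refine hasQSeries_E₈.eq_of_weight_lt_twelve (hasQSeries_E₄.mul hasQSeries_E₄)
    (ModularFormClass.holo _) ((ModularFormClass.holo E₄).mul (ModularFormClass.holo E₄)) (k := 8)
    (E_slash _) (fun γ ↦ ?_) (by norm_num) 
    (by simp [constantCoeff_map_ringHom, constantCoeff_eisensteinPowerSeries])
  have h := mul_slash_SL2 4 4 γ E₄ E₄
  rwa [show (E₄ : ℍ → ℂ) ∣[(4 : ℤ)] γ = E₄ from E_slash _ γ] at h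

theorem eisensteinPowerSeries_ten : 𝐓 = 𝐐 * 𝐑 := by
  refine map_intCast_injective ?_
  rw [map_mul]
  refine hasQSeries_E₁₀.eq_of_weight_lt_twelve (hasQSeries_E₄.mul hasQSeries_E₆)
    (ModularFormClass.holo _) ((ModularFormClass.holo E₄).mul (ModularFormClass.holo E₆)) (k := 10)
    (E_slash _) (fun γ ↦ ?_) (by norm_num) 
    (by simp [constantCoeff_map_ringHom, constantCoeff_eisensteinPowerSeries])
  have h := mul_slash_SL2 4 6 γ E₄ E₆
  rwa [show (E₄ : ℍ → ℂ) ∣[(4 : ℤ)] γ = E₄ from E_slash _ γ,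
    show (E₆ : ℍ → ℂ) ∣[(6 : ℤ)] γ = E₆ from E_slash _ γ] at h

/-- The Serre derivative of `f` has constant term `-k/12`, so in weight `l < 12` it must be `-(k/12)
g`. -/
theorem HasQSeries.serreDerivative_eq_smul {f g : ℍ → ℂ} {c d : ℤ⟦X⟧} {k l : ℕ}
    (hf : HasQSeries f (map (Int.castRingHom ℂ) c)) (hg : HasQSeries g (map (Int.castRingHom ℂ) d))
    (holf : MDiff f) (holg : MDiff g)
    (hkf : ∀ γ : SL(2, ℤ), serreDerivative k f ∣[(l : ℤ)] γ = serreDerivative k f)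
    (hkg : ∀ γ : SL(2, ℤ), g ∣[(l : ℤ)] γ = g) (hl : l < 12)
    (hc : constantCoeff c = 1) (hd : constantCoeff d = 1) :
    12 * θ c = k * (𝐏 * c - d) := by
  refine map_intCast_injective ?_
  have h := (serreDerivative_hasQSeries k hf).eq_of_weight_lt_twelve (hg.smul (-(k * 12⁻¹)))
    (serreDerivative_mdifferentiable k holf) (holg.const_smul _) hkf
    (fun γ ↦ by rw [SL_smul_slash, hkg]) hl ?_
  · have hk : (12 : ℂ⟦X⟧) * C ((k : ℂ) * 12⁻¹) = k := by
      rw [show (12 : ℂ⟦X⟧) = C 12 from (map_ofNat C 12).symm, ← map_mul,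
        mul_comm (k : ℂ), mul_inv_cancel_left₀ (by norm_num), map_natCast]
    rw [← map_eulerDerivation, smul_eq_C_mul, smul_eq_C_mul, map_neg] at h
    simp only [map_mul, map_sub, map_natCast, map_ofNat]
    linear_combination 12 * h + (map (Int.castRingHom ℂ) 𝐏 * map (Int.castRingHom ℂ) c -
      map (Int.castRingHom ℂ) d) * hk
  · simp [constantCoeff_eulerDerivation, smul_eq_C_mul, constantCoeff_map_ringHom, hc, hd,
      constantCoeff_eisensteinPowerSeries]

theorem eulerDerivation_eisensteinPowerSeries_two : 12 * θ 𝐏 = 𝐏 ^ 2 - 𝐐 := by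
  have h := hasQSeries_E2.serreDerivative_eq_smul (k := 1) (l := 4) hasQSeries_E₄ E2_mdifferentiable
    (ModularFormClass.holo _) (fun γ ↦ by simpa using serreDerivative_one_E2_slash γ) (E_slash _)
    (by norm_num) (constantCoeff_eisensteinPowerSeries _ _)
    (constantCoeff_eisensteinPowerSeries _ _)
  linear_combination h

theorem eulerDerivation_eisensteinPowerSeries_four : 3 * θ 𝐐 = 𝐏 * 𝐐 - 𝐑 := by
  have h := hasQSeries_E₄.serreDerivative_eq_smul (k := 4) (l := 6) hasQSeries_E₆
    (ModularFormClass.holo _) (ModularFormClass.holo _)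
    (fun γ ↦ serreDerivative_slash_invariant (k := 4) (ModularFormClass.holo _) (E_slash _ γ))
    (E_slash _) (by norm_num) (constantCoeff_eisensteinPowerSeries _ _)
    (constantCoeff_eisensteinPowerSeries _ _)
  refine mul_left_cancel₀ (by norm_num : (4 : ℤ⟦X⟧) ≠ 0) ?_
  linear_combination h

theorem eulerDerivation_eisensteinPowerSeries_six : 2 * θ 𝐑 = 𝐏 * 𝐑 - 𝐐 ^ 2 := by
  have h := hasQSeries_E₆.serreDerivative_eq_smul (k := 6) (l := 8) hasQSeries_E₈
    (ModularFormClass.holo _) (ModularFormClass.holo _)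
    (fun γ ↦ serreDerivative_slash_invariant (k := 6) (ModularFormClass.holo _) (E_slash _ γ))
    (E_slash _) (by norm_num) (constantCoeff_eisensteinPowerSeries _ _)
    (constantCoeff_eisensteinPowerSeries _ _)
  rw [eisensteinPowerSeries_eight] at h
  refine mul_left_cancel₀ (by norm_num : (6 : ℤ⟦X⟧) ≠ 0) ?_
  linear_combination h

end Ramanujan

/-! ### Differential algebra: multiples of `Q³ - R²` as combinations of derivatives. -/

section RamanujanSystem

variable {k A : Type*} [CommRing k] [CommRing A] [Algebra k A] {δ : Derivation k A A} {P Q R : A}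

/-- Elements `P`, `Q`, `R` of a ring with derivation satisfying Ramanujan's differential
equations. -/
structure IsRamanujanSystem (δ : Derivation k A A) (P Q R : A) : Prop where
  deriv_P : 12 * δ P = P ^ 2 - Q
  deriv_Q : 3 * δ Q = P * Q - R
  deriv_R : 2 * δ R = P * R - Q ^ 2

theorem Derivation.map_ofNat_eq_zero (δ : Derivation k A A) (n : ℕ) [n.AtLeastTwo] :
    δ (no_index (OfNat.ofNat n)) = 0 :=
  δ.map_natCast n

namespace IsRamanujanSystem

/-- For a polynomial `F` in `P`, `Q`, `R`, the chain rule reads `12 δF = F_P (12 δP) + 4 F_Q (3 δQ)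
+ 6 F_R (2 δR)`. Hence the multipliers `F_P`, `4 F_Q`, `6 F_R` of the three equations here and in
the higher derivatives of `P`, `Q`, `R` below. -/
theorem deriv_deriv_P [IsDomain A] [CharZero A] (h : IsRamanujanSystem δ P Q R) :
    72 * δ (δ P) = P ^ 3 - 3 * P * Q + 2 * R := by
  have h' := congr_arg δ h.deriv_P
  simp only [map_sub, Derivation.leibniz, Derivation.leibniz_pow,
    smul_eq_mul, nsmul_eq_mul, Derivation.map_ofNat_eq_zero] at h'
  refine mul_left_cancel₀ (by norm_num : (2 : A) ≠ 0) ?_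
  linear_combination (norm := (push_cast; ring)) 12 * h' + 2 * P * h.deriv_P - 4 * h.deriv_Q

theorem deriv_deriv_deriv_P [IsDomain A] [CharZero A] (h : IsRamanujanSystem δ P Q R) :
    288 * δ (δ (δ P)) = P ^ 4 - 6 * P ^ 2 * Q + 8 * P * R - 3 * Q ^ 2 := by
  have h' := congr_arg δ h.deriv_deriv_P
  simp only [map_sub, map_add, Derivation.leibniz, Derivation.leibniz_pow,
    smul_eq_mul, nsmul_eq_mul, Derivation.map_ofNat_eq_zero] at h'
  refine mul_left_cancel₀ (by norm_num : (3 : A) ≠ 0) ?_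
  linear_combination (norm := (push_cast; ring)) 12 * h' + 3 * (P ^ 2 - Q) * h.deriv_P -
      12 * P * h.deriv_Q + 12 * h.deriv_R

theorem deriv_deriv_Q (h : IsRamanujanSystem δ P Q R) :
    36 * δ (δ Q) = 5 * P ^ 2 * Q - 10 * P * R + 5 * Q ^ 2 := by
  have h' := congr_arg δ h.deriv_Q
  simp only [map_sub, Derivation.leibniz, smul_eq_mul, Derivation.map_ofNat_eq_zero] at h'
  linear_combination (norm := (push_cast; ring)) 12 * h' + Q * h.deriv_P + 4 * P * h.deriv_Q -
      6 * h.deriv_R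

theorem deriv_deriv_deriv_Q [IsDomain A] [CharZero A] (h : IsRamanujanSystem δ P Q R) :
    72 * δ (δ (δ Q)) = 5 * P ^ 3 * Q - 15 * P ^ 2 * R + 15 * P * Q ^ 2 - 5 * Q * R := by
  have h' := congr_arg δ h.deriv_deriv_Q
  simp only [map_sub, map_add, Derivation.leibniz, Derivation.leibniz_pow,
    smul_eq_mul, nsmul_eq_mul, Derivation.map_ofNat_eq_zero] at h'
  refine mul_left_cancel₀ (by norm_num : (6 : A) ≠ 0) ?_
  linear_combination (norm := (push_cast; ring)) 12 * h' + 10 * (P * Q - R) * h.deriv_P +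
      20 * (P ^ 2 + 2 * Q) * h.deriv_Q - 60 * P * h.deriv_R

theorem deriv_deriv_deriv_deriv_Q [IsDomain A] [CharZero A] (h : IsRamanujanSystem δ P Q R) :
    864 * δ (δ (δ (δ Q))) = 35 * P ^ 4 * Q - 140 * P ^ 3 * R + 210 * P ^ 2 * Q ^ 2 -
      140 * P * Q * R + 15 * Q ^ 3 + 20 * R ^ 2 := by
  have h' := congr_arg δ h.deriv_deriv_deriv_Q
  simp only [map_sub, map_add, Derivation.leibniz, Derivation.leibniz_pow,
    smul_eq_mul, nsmul_eq_mul, Derivation.map_ofNat_eq_zero] at h'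
  linear_combination (norm := (push_cast; ring)) 12 * h' + 15 * (P ^ 2 * Q - 2 * P * R +
      Q ^ 2) * h.deriv_P + 20 * (P ^ 3 + 6 * P * Q - R) * h.deriv_Q - 30 * (3 * P ^ 2 +
      Q) * h.deriv_R

theorem deriv_deriv_R (h : IsRamanujanSystem δ P Q R) :
    24 * δ (δ R) = 7 * P ^ 2 * R - 14 * P * Q ^ 2 + 7 * Q * R := by
  have h' := congr_arg δ h.deriv_R
  simp only [map_sub, Derivation.leibniz, Derivation.leibniz_pow,
    smul_eq_mul, nsmul_eq_mul, Derivation.map_ofNat_eq_zero] at h'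
  linear_combination (norm := (push_cast; ring)) 12 * h' + R * h.deriv_P - 8 * Q * h.deriv_Q +
      6 * P * h.deriv_R

theorem deriv_deriv_deriv_R [IsDomain A] [CharZero A] (h : IsRamanujanSystem δ P Q R) :
    72 * δ (δ (δ R)) = 14 * P ^ 3 * R - 42 * P ^ 2 * Q ^ 2 + 42 * P * Q * R - 7 * Q ^ 3 -
      7 * R ^ 2 := by
  have h' := congr_arg δ h.deriv_deriv_R
  simp only [map_sub, map_add, Derivation.leibniz, Derivation.leibniz_pow,
    smul_eq_mul, nsmul_eq_mul, Derivation.map_ofNat_eq_zero] at h'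
  refine mul_left_cancel₀ (by norm_num : (4 : A) ≠ 0) ?_
  linear_combination (norm := (push_cast; ring)) 12 * h' + 14 * (P * R - Q ^ 2) * h.deriv_P +
      28 * (-4 * P * Q + R) * h.deriv_Q + 42 * (P ^ 2 + Q) * h.deriv_R

/-- `Q²` and `Q R` are treated as units because they are the Eisenstein series of weights 8 and 10,
the source of `σ 7` and `σ 9`. -/
theorem deriv_Q_sq (h : IsRamanujanSystem δ P Q R) :
    3 * δ (Q ^ 2) = 2 * P * Q ^ 2 - 2 * Q * R := by
  rw [Derivation.leibniz_pow, smul_eq_mul, nsmul_eq_mul]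
  linear_combination (norm := (push_cast; ring)) 2 * Q * h.deriv_Q

theorem deriv_deriv_Q_sq (h : IsRamanujanSystem δ P Q R) :
    18 * δ (δ (Q ^ 2)) = 9 * P ^ 2 * Q ^ 2 - 18 * P * Q * R + 5 * Q ^ 3 + 4 * R ^ 2 := by
  simp only [Derivation.leibniz_pow, Derivation.leibniz, smul_eq_mul, nsmul_eq_mul,
    Derivation.map_natCast]
  linear_combination (norm := (push_cast; ring)) Q * h.deriv_deriv_Q +
    4 * (3 * δ Q + P * Q - R) * h.deriv_Q

theorem deriv_Q_mul_R (h : IsRamanujanSystem δ P Q R) :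
    6 * δ (Q * R) = 5 * P * Q * R - 3 * Q ^ 3 - 2 * R ^ 2 := by
  rw [Derivation.leibniz, smul_eq_mul, smul_eq_mul]
  linear_combination 2 * R * h.deriv_Q + 3 * Q * h.deriv_R

theorem mul_delta_1728 (h : IsRamanujanSystem δ P Q R) {D : A}
    (hD : 1728 * D = Q ^ 3 - R ^ 2) :
    1728 * D = 3 * δ Q * R - 2 * δ R * Q := by
  linear_combination hD - R * h.deriv_Q + Q * h.deriv_R

theorem mul_delta_1536 [IsDomain A] [CharZero A] (h : IsRamanujanSystem δ P Q R) {D : A}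
    (hD : 1728 * D = Q ^ 3 - R ^ 2) :
    1536 * D = -30 * δ P * Q ^ 2 + 5 * δ (δ (Q ^ 2)) + 6 * δ (Q * R) := by
  refine mul_left_cancel₀ (by norm_num : (18 : A) ≠ 0) ?_
  linear_combination 16 * hD + 45 * Q ^ 2 * h.deriv_P - 5 * h.deriv_deriv_Q_sq -
      18 * h.deriv_Q_mul_R

theorem mul_delta_2352 [IsDomain A] [CharZero A] (h : IsRamanujanSystem δ P Q R) {D : A}
    (hD : 1728 * D = Q ^ 3 - R ^ 2) :
    2352 * D = -84 * δ (δ P) * R + 6 * δ (δ (δ R)) + 7 * δ (δ (Q ^ 2)) := by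
  refine mul_left_cancel₀ (by norm_num : (36 : A) ≠ 0) ?_
  linear_combination 49 * hD + 42 * R * h.deriv_deriv_P - 3 * h.deriv_deriv_deriv_R -
      14 * h.deriv_deriv_Q_sq

theorem mul_delta_600 [IsDomain A] [CharZero A] (h : IsRamanujanSystem δ P Q R) {D : A}
    (hD : 1728 * D = Q ^ 3 - R ^ 2) :
    600 * D = -70 * δ (δ (δ P)) * Q + 6 * δ (δ (δ (δ Q))) + 5 * δ (δ (δ R)) := by
  refine mul_left_cancel₀ (by norm_num : (144 : A) ≠ 0) ?_
  linear_combination 50 * hD + 35 * Q * h.deriv_deriv_deriv_P - h.deriv_deriv_deriv_deriv_Q -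
      10 * h.deriv_deriv_deriv_R

theorem mul_delta_2304 [IsDomain A] [CharZero A] (h : IsRamanujanSystem δ P Q R) {D : A}
    (hD : 1728 * D = Q ^ 3 - R ^ 2) :
    2304 * D = -40 * δ P * Q ^ 2 + 5 * δ (Q ^ 2) * P + 4 * δ (Q * R) := by
  refine mul_left_cancel₀ (by norm_num : (3 : A) ≠ 0) ?_
  linear_combination 4 * hD + 10 * Q ^ 2 * h.deriv_P - 5 * P * h.deriv_Q_sq - 2 * h.deriv_Q_mul_R

theorem mul_delta_1344 [IsDomain A] [CharZero A] (h : IsRamanujanSystem δ P Q R) {D : A}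
    (hD : 1728 * D = Q ^ 3 - R ^ 2) :
    1344 * D = -36 * δ (δ P) * R + δ (δ (Q ^ 2)) + 12 * δ P * δ R := by
  refine mul_left_cancel₀ (by norm_num : (18 : A) ≠ 0) ?_
  linear_combination 14 * hD + 9 * R * h.deriv_deriv_P - h.deriv_deriv_Q_sq -
      18 * δ R * h.deriv_P - 9 * (P ^ 2 - Q) * h.deriv_R

theorem mul_delta_840 [IsDomain A] [CharZero A] (h : IsRamanujanSystem δ P Q R) {D : A}
    (hD : 1728 * D = Q ^ 3 - R ^ 2) :
    840 * D = -56 * δ (δ (δ P)) * Q + δ (δ (δ R)) + 42 * δ (δ P) * δ Q := by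
  refine mul_left_cancel₀ (by norm_num : (72 : A) ≠ 0) ?_
  linear_combination 35 * hD + 14 * Q * h.deriv_deriv_deriv_P - h.deriv_deriv_deriv_R -
      42 * δ Q * h.deriv_deriv_P - 14 * (P ^ 3 - 3 * P * Q + 2 * R) * h.deriv_Q

theorem mul_delta_1008 [IsDomain A] [CharZero A] (h : IsRamanujanSystem δ P Q R) {D : A}
    (hD : 1728 * D = Q ^ 3 - R ^ 2) :
    1008 * D = -21 * δ (δ P) * R - δ (δ R) * P + 14 * δ P * δ R := by
  refine mul_left_cancel₀ (by norm_num : (24 : A) ≠ 0) ?_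
  linear_combination 14 * hD + 7 * R * h.deriv_deriv_P + P * h.deriv_deriv_R -
      28 * δ R * h.deriv_P - 14 * (P ^ 2 - Q) * h.deriv_R

end IsRamanujanSystem

end RamanujanSystem

/-! ### The product `Δ` and its expression through `Q` and `R`. -/

section Delta

open PowerSeries Filter Topology

local notation "θ" => eulerDerivation ℤ
local notation "𝐏" => eisensteinPowerSeries (-24) 1
local notation "𝐐" => eisensteinPowerSeries 240 3
local notation "𝐑" => eisensteinPowerSeries (-504) 5

/-- The power series `Δ = X * ∏ (1 - X ^ m) ^ 24`. -/
noncomputable def ramanujanDelta : ℤ⟦X⟧ :=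
  X * ∏' m : ℕ, ((1 : ℤ⟦X⟧) - X ^ (m + 1)) ^ 24

theorem coeff_ramanujanDelta (n : ℕ) : coeff n ramanujanDelta = ramanujanTau n := rfl

theorem tendsto_ramanujanDelta :
    Tendsto (fun N : ℕ ↦ (X : ℤ⟦X⟧) * ∏ m ∈ Finset.range N, (1 - X ^ (m + 1)) ^ 24) atTop
      (𝓝 ramanujanDelta) :=
  multipliable_ramanujanTau_factors.hasProd.tendsto_prod_nat.const_mul X

/-- The series `∑ (m + 1) X ^ j` over the positive multiples `j` of `m + 1`. -/
noncomputable def multiplesSeries (m : ℕ) : ℤ⟦X⟧ :=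
  PowerSeries.mk fun n ↦ if n ≠ 0 ∧ m + 1 ∣ n then (m + 1 : ℤ) else 0

/-- Division-free form of the Lambert term `(m + 1) X^(m+1) / (1 - X^(m+1))`, the geometric series
occurring in logarithmic derivatives. -/
theorem one_sub_X_pow_mul_multiplesSeries (m : ℕ) :
    (1 - X ^ (m + 1)) * multiplesSeries m = (m + 1 : ℤ⟦X⟧) * X ^ (m + 1) := by
  ext n
  rw [show (m + 1 : ℤ⟦X⟧) = C (m + 1 : ℤ) by simp, coeff_C_mul, coeff_X_pow, sub_mul, one_mul,
    map_sub, coeff_X_pow_mul', multiplesSeries, coeff_mk, coeff_mk]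
  rcases lt_trichotomy n (m + 1) with h | rfl | h
  · have h1 : ¬ (n ≠ 0 ∧ m + 1 ∣ n) := fun ⟨h0, h1⟩ ↦
      h.not_ge (Nat.le_of_dvd (Nat.pos_of_ne_zero h0) h1)
    simp [h1, h.not_ge, h.ne]
  · simp
  · have h1 : m + 1 ∣ n - (m + 1) ↔ m + 1 ∣ n := Nat.dvd_sub_self_right.trans (by grind)
    simp [h.le, h.ne', h1, show n ≠ 0 by omega, show n - (m + 1) ≠ 0 by omega]

theorem eulerDerivation_one_sub_X_pow (m : ℕ) :
    θ ((1 - X ^ (m + 1)) ^ 24) = (1 - X ^ (m + 1)) ^ 24 * (-24 * multiplesSeries m) := by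
  have h : θ (X ^ (m + 1)) = (m + 1 : ℤ⟦X⟧) * X ^ (m + 1) := by
    ext n
    rw [show (m + 1 : ℤ⟦X⟧) = C (m + 1 : ℤ) by simp, coeff_C_mul, coeff_eulerDerivation,
      coeff_X_pow]
    split_ifs with hn <;> simp [hn]
  rw [Derivation.leibniz_pow, map_sub, Derivation.map_one_eq_zero, h,
    ← one_sub_X_pow_mul_multiplesSeries]
  simp only [smul_eq_mul, nsmul_eq_mul]
  push_cast
  ring

theorem eulerDerivation_prod (N : ℕ) :
    θ (X * ∏ m ∈ Finset.range N, (1 - X ^ (m + 1)) ^ 24) =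
      (X * ∏ m ∈ Finset.range N, (1 - X ^ (m + 1)) ^ 24) *
        (1 - 24 * ∑ m ∈ Finset.range N, multiplesSeries m) := by
  induction N with
  | zero =>
    ext n
    simp only [Finset.range_zero, Finset.prod_empty, Finset.sum_empty, mul_zero, sub_zero, mul_one,
      coeff_eulerDerivation, coeff_X]
    split_ifs with hn <;> simp [hn]
  | succ N ih =>
    rw [Finset.prod_range_succ, Finset.sum_range_succ, ← mul_assoc, Derivation.leibniz, ih,
      eulerDerivation_one_sub_X_pow]
    simp only [smul_eq_mul]
    ring

theorem coeff_sum_multiplesSeries {n N : ℕ} (h : n ≤ N) :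
    coeff n (∑ m ∈ Finset.range N, multiplesSeries m) = (σ 1 n : ℤ) := by
  rw [map_sum, ArithmeticFunction.sigma_one_apply]
  rcases eq_or_ne n 0 with rfl | hn
  · simp [multiplesSeries]
  · simp only [multiplesSeries, coeff_mk, hn, ne_eq, not_false_eq_true, true_and]
    rw [← Finset.sum_filter, Nat.cast_sum]
    -- The index `m` corresponds to the divisor `m + 1`; `n ≤ N` ensures that none is missed.
    refine Finset.sum_nbij' (· + 1) (· - 1) ?_ ?_ ?_ ?_ ?_
    · simp +contextual [hn]
    · intro d hd
      obtain ⟨hd, -⟩ := Nat.mem_divisors.mp hd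
      have h1 := Nat.pos_of_dvd_of_pos hd (Nat.pos_of_ne_zero hn)
      have h2 := Nat.le_of_dvd (Nat.pos_of_ne_zero hn) hd
      rw [Finset.mem_filter, Finset.mem_range, Nat.sub_add_cancel h1]
      exact ⟨by omega, hd⟩
    · simp
    · intro d hd
      exact Nat.sub_add_cancel (Nat.pos_of_mem_divisors hd)
    · simp

theorem tendsto_one_sub_sum_multiplesSeries :
    Tendsto (fun N : ℕ ↦ (1 - 24 * ∑ m ∈ Finset.range N, multiplesSeries m : ℤ⟦X⟧)) atTop
      (𝓝 𝐏) := by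
  rw [PowerSeries.WithPiTopology.tendsto_iff_coeff_tendsto]
  refine fun n ↦ tendsto_const_nhds.congr' ?_
  filter_upwards [eventually_ge_atTop n] with N hN
  rw [eisensteinPowerSeries, show (24 : ℤ⟦X⟧) = C 24 from (map_ofNat C 24).symm, map_sub,
    coeff_C_mul, coeff_sum_multiplesSeries hN, map_add, map_zsmul, coeff_sigmaSeries, smul_eq_mul]
  ring

/-- Limit of the finite products: `θ` scales each coefficient, hence commutes with coefficientwise
limits. -/
theorem eulerDerivation_ramanujanDelta : θ ramanujanDelta = ramanujanDelta * 𝐏 := by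
  have h1 := tendsto_ramanujanDelta.mul tendsto_one_sub_sum_multiplesSeries
  simp_rw [← eulerDerivation_prod] at h1
  refine tendsto_nhds_unique ?_ h1
  rw [PowerSeries.WithPiTopology.tendsto_iff_coeff_tendsto]
  intro n
  simp only [coeff_eulerDerivation]
  exact ((PowerSeries.WithPiTopology.tendsto_iff_coeff_tendsto _ _ _ _).mp
    tendsto_ramanujanDelta n).const_mul _

/-- As `p` starts with `1`, comparing coefficients expresses `(n - 1) aₙ` through earlier `aᵢ`; only
`n = 1` leaves freedom. -/
theorem eq_zero_of_eulerDerivation_eq_mul {f p : ℤ⟦X⟧} (h : θ f = f * p)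
    (hp : constantCoeff p = 1) (h0 : coeff 0 f = 0) (h1 : coeff 1 f = 0) : f = 0 := by
  ext n
  induction n using Nat.strong_induction_on with
  | _ n ih =>
    rcases Nat.lt_or_ge n 2 with hn | hn
    · interval_cases n
      · rw [h0, map_zero]
      · rw [h1, map_zero]
    have hc := congr_arg (coeff n) h
    rw [coeff_eulerDerivation, coeff_mul, Finset.sum_eq_single (n, 0)] at hc
    · simp only [coeff_zero_eq_constantCoeff, hp, mul_one] at hc
      have hn' : ((n : ℤ) - 1) ≠ 0 := by omega
      refine (mul_eq_zero.mp (?_ : ((n : ℤ) - 1) * _ = 0)).resolve_left hn'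
      linear_combination hc
    · rintro ⟨i, j⟩ hij hne
      rw [Finset.HasAntidiagonal.mem_antidiagonal] at hij
      have hi : i < n := by
        by_contra hi
        exact hne (by ext <;> simp at * <;> omega)
      simp [ih i hi]
    · simp

theorem coeff_one_ramanujanDelta : coeff 1 ramanujanDelta = 1 := by
  refine tendsto_nhds_unique ((PowerSeries.WithPiTopology.tendsto_iff_coeff_tendsto _ _ _ _).mp
    tendsto_ramanujanDelta 1) (tendsto_const_nhds.congr fun N ↦ ?_)
  rw [show 1 = 0 + 1 from rfl, coeff_succ_X_mul]
  simp

theorem isRamanujanSystem_eisensteinPowerSeries : IsRamanujanSystem θ 𝐏 𝐐 𝐑 :=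
  ⟨eulerDerivation_eisensteinPowerSeries_two, eulerDerivation_eisensteinPowerSeries_four,
    eulerDerivation_eisensteinPowerSeries_six⟩

theorem ramanujanDelta_eq : 1728 * ramanujanDelta = 𝐐 ^ 3 - 𝐑 ^ 2 := by
  have h := isRamanujanSystem_eisensteinPowerSeries
  rw [← sub_eq_zero]
  refine eq_zero_of_eulerDerivation_eq_mul (p := 𝐏) ?_
    (constantCoeff_eisensteinPowerSeries _ _) ?_ ?_
  · simp only [map_sub, Derivation.leibniz, Derivation.leibniz_pow, smul_eq_mul, nsmul_eq_mul,
      Derivation.map_ofNat_eq_zero, eulerDerivation_ramanujanDelta]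
    push_cast
    linear_combination -𝐐 ^ 2 * h.deriv_Q + 𝐑 * h.deriv_R
  · simp [constantCoeff_eisensteinPowerSeries, ramanujanDelta]
  -- The coefficients of `X` agree since `3 · 240 + 2 · 504 = 1728`.
  · rw [show (1728 : ℤ⟦X⟧) = C 1728 from (map_ofNat C 1728).symm, map_sub, coeff_C_mul,
      coeff_one_ramanujanDelta, pow_succ, pow_two, pow_two, map_sub]
    simp [coeff_mul, Finset.Nat.antidiagonal_succ, coeff_eisensteinPowerSeries]

end Delta

/-! ### Expansion in divisor sums and comparison of coefficients. -/

section Congruences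

open PowerSeries

local notation "θ" => eulerDerivation ℤ
local notation "𝐬" => sigmaSeries

theorem eisensteinPowerSeries_eq (a : ℤ) (k : ℕ) :
    eisensteinPowerSeries a k = 1 + (a : ℤ⟦X⟧) * sigmaSeries k := by
  rw [eisensteinPowerSeries, zsmul_eq_mul]

theorem eulerDerivation_eisensteinPowerSeries (a : ℤ) (k : ℕ) :
    θ (eisensteinPowerSeries a k) = a • θ (sigmaSeries k) := by
  rw [eisensteinPowerSeries, map_add, Derivation.map_one_eq_zero, zero_add, map_zsmul]

theorem PowerSeries.coeff_modEq_of_eq_add_smul {f g w : ℤ⟦X⟧} {N : ℤ} (h : f = g + N • w) (n : ℕ) :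
    coeff n f ≡ coeff n g [ZMOD N] := by
  rw [h, map_add, map_zsmul, smul_eq_mul]
  exact Int.modEq_iff_dvd.mpr ⟨-coeff n w, by ring⟩

theorem smul_ramanujanDelta_eq_add_840_smul :
    (12 : ℤ) • ramanujanDelta =
      (5 : ℤ) • θ (𝐬 3) + (7 : ℤ) • θ (𝐬 5) +
      (840 : ℤ) • (2 * (θ (𝐬 5) * 𝐬 3) - 3 * (θ (𝐬 3) * 𝐬 5)) := by
  have h := isRamanujanSystem_eisensteinPowerSeries.mul_delta_1728 ramanujanDelta_eq
  simp only [eulerDerivation_eisensteinPowerSeries] at h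
  simp only [eisensteinPowerSeries_eq, zsmul_eq_mul] at h ⊢
  push_cast at h ⊢
  -- `144 = 1728 / 12` divides all coefficients, and the quadratic ones are multiples of `240 · 504
  -- = 144 · 840`. The next seven lemmas cancel a common factor in the same way.
  refine mul_left_cancel₀ (by norm_num : (144 : ℤ⟦X⟧) ≠ 0) ?_
  linear_combination h

theorem smul_ramanujanDelta_eq_add_7200_smul :
    (32 : ℤ) • ramanujanDelta =
      (15 : ℤ) • θ (𝐬 1) + (50 : ℤ) • θ (θ (𝐬 7)) - (33 : ℤ) • θ (𝐬 9) +
      (7200 : ℤ) • (θ (𝐬 1) * 𝐬 7) := by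
  have h := isRamanujanSystem_eisensteinPowerSeries.mul_delta_1536 ramanujanDelta_eq
  -- Reading `Q²` and `Q R` as single Eisenstein series makes `σ 7` and `σ 9` enter linearly.
  simp only [← eisensteinPowerSeries_eight, ← eisensteinPowerSeries_ten] at h
  simp only [eulerDerivation_eisensteinPowerSeries, map_zsmul] at h
  simp only [eisensteinPowerSeries_eq, zsmul_eq_mul] at h ⊢
  push_cast at h ⊢
  refine mul_left_cancel₀ (by norm_num : (48 : ℤ⟦X⟧) ≠ 0) ?_
  linear_combination h

theorem smul_ramanujanDelta_eq_add_3024_smul :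
    (7 : ℤ) • ramanujanDelta =
      (6 : ℤ) • θ (θ (𝐬 1)) - (9 : ℤ) • θ (θ (θ (𝐬 5))) + (10 : ℤ) • θ (θ (𝐬 7)) +
      (3024 : ℤ) • (-(θ (θ (𝐬 1)) * 𝐬 5)) := by
  have h := isRamanujanSystem_eisensteinPowerSeries.mul_delta_2352 ramanujanDelta_eq
  simp only [← eisensteinPowerSeries_eight] at h
  simp only [eulerDerivation_eisensteinPowerSeries, map_zsmul] at h
  simp only [eisensteinPowerSeries_eq, zsmul_eq_mul] at h ⊢
  push_cast at h ⊢
  refine mul_left_cancel₀ (by norm_num : (336 : ℤ⟦X⟧) ≠ 0) ?_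
  linear_combination h

theorem smul_ramanujanDelta_eq_add_3360_smul :
    (5 : ℤ) • ramanujanDelta =
      (14 : ℤ) • θ (θ (θ (𝐬 1))) + (12 : ℤ) • θ (θ (θ (θ (𝐬 3)))) - (21 : ℤ) • θ (θ (θ (𝐬 5))) +
      (3360 : ℤ) • (θ (θ (θ (𝐬 1))) * 𝐬 3) := by
  have h := isRamanujanSystem_eisensteinPowerSeries.mul_delta_600 ramanujanDelta_eq
  simp only [eulerDerivation_eisensteinPowerSeries, map_zsmul] at h
  simp only [eisensteinPowerSeries_eq, zsmul_eq_mul] at h ⊢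
  push_cast at h ⊢
  refine mul_left_cancel₀ (by norm_num : (120 : ℤ⟦X⟧) ≠ 0) ?_
  linear_combination h

theorem smul_ramanujanDelta_eq_add_600_smul :
    (24 : ℤ) • ramanujanDelta =
      (10 : ℤ) • θ (𝐬 1) + (25 : ℤ) • θ (𝐬 7) - (11 : ℤ) • θ (𝐬 9) +
      (600 : ℤ) • (8 * (θ (𝐬 1) * 𝐬 7) - θ (𝐬 7) * 𝐬 1) := by
  have h := isRamanujanSystem_eisensteinPowerSeries.mul_delta_2304 ramanujanDelta_eq
  simp only [← eisensteinPowerSeries_eight, ← eisensteinPowerSeries_ten] at h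
  simp only [eulerDerivation_eisensteinPowerSeries] at h
  simp only [eisensteinPowerSeries_eq, zsmul_eq_mul] at h ⊢
  push_cast at h ⊢
  refine mul_left_cancel₀ (by norm_num : (96 : ℤ⟦X⟧) ≠ 0) ?_
  linear_combination h

theorem smul_ramanujanDelta_eq_add_1512_smul :
    (14 : ℤ) • ramanujanDelta =
      (9 : ℤ) • θ (θ (𝐬 1)) + (5 : ℤ) • θ (θ (𝐬 7)) +
      (1512 : ℤ) • (θ (𝐬 1) * θ (𝐬 5) - 3 * (θ (θ (𝐬 1)) * 𝐬 5)) := by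
  have h := isRamanujanSystem_eisensteinPowerSeries.mul_delta_1344 ramanujanDelta_eq
  simp only [← eisensteinPowerSeries_eight] at h
  simp only [eulerDerivation_eisensteinPowerSeries, map_zsmul] at h
  simp only [eisensteinPowerSeries_eq, zsmul_eq_mul] at h ⊢
  push_cast at h ⊢
  refine mul_left_cancel₀ (by norm_num : (96 : ℤ⟦X⟧) ≠ 0) ?_
  linear_combination h

theorem smul_ramanujanDelta_eq_add_480_smul :
    (5 : ℤ) • ramanujanDelta =
      (8 : ℤ) • θ (θ (θ (𝐬 1))) - (3 : ℤ) • θ (θ (θ (𝐬 5))) +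
      (480 : ℤ) • (4 * (θ (θ (θ (𝐬 1))) * 𝐬 3) - 3 * (θ (θ (𝐬 1)) * θ (𝐬 3))) := by
  have h := isRamanujanSystem_eisensteinPowerSeries.mul_delta_840 ramanujanDelta_eq
  simp only [eulerDerivation_eisensteinPowerSeries, map_zsmul] at h
  simp only [eisensteinPowerSeries_eq, zsmul_eq_mul] at h ⊢
  push_cast at h ⊢
  refine mul_left_cancel₀ (by norm_num : (168 : ℤ⟦X⟧) ≠ 0) ?_
  linear_combination h

theorem smul_ramanujanDelta_eq_add_24_smul :
    (2 : ℤ) • ramanujanDelta =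
      θ (θ (𝐬 1)) + θ (θ (𝐬 5)) +
      (24 : ℤ) • (14 * (θ (𝐬 1) * θ (𝐬 5)) - 21 * (θ (θ (𝐬 1)) * 𝐬 5) - θ (θ (𝐬 5)) * 𝐬 1) := by
  have h := isRamanujanSystem_eisensteinPowerSeries.mul_delta_1008 ramanujanDelta_eq
  simp only [eulerDerivation_eisensteinPowerSeries, map_zsmul] at h
  simp only [eisensteinPowerSeries_eq, zsmul_eq_mul] at h ⊢
  push_cast at h ⊢
  refine mul_left_cancel₀ (by norm_num : (504 : ℤ⟦X⟧) ≠ 0) ?_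
  linear_combination h

end Congruences

theorem corollary2p8 (n : ℕ) (hn : 1 ≤ n) :
    (12 * ramanujanTau n ≡
        5 * (n : ℤ) * (σ 3 n : ℤ) + 7 * (n : ℤ) * (σ 5 n : ℤ)
        [ZMOD 2 ^ 3 * 3 * 5 * 7]) ∧
    (32 * ramanujanTau n ≡
        15 * (n : ℤ) * (σ 1 n : ℤ) + 50 * (n : ℤ) ^ 2 * (σ 7 n : ℤ) - 33 * (n : ℤ) * (σ 9 n : ℤ)
        [ZMOD 2 ^ 5 * 3 ^ 2 * 5 ^ 2]) ∧
    (7 * ramanujanTau n ≡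
        6 * (n : ℤ) ^ 2 * (σ 1 n : ℤ) - 9 * (n : ℤ) ^ 3 * (σ 5 n : ℤ)
          + 10 * (n : ℤ) ^ 2 * (σ 7 n : ℤ)
        [ZMOD 2 ^ 4 * 3 ^ 3 * 7]) ∧
    (5 * ramanujanTau n ≡
        14 * (n : ℤ) ^ 3 * (σ 1 n : ℤ) + 12 * (n : ℤ) ^ 4 * (σ 3 n : ℤ)
          - 21 * (n : ℤ) ^ 3 * (σ 5 n : ℤ)
        [ZMOD 2 ^ 5 * 3 * 5 * 7]) ∧
    (24 * ramanujanTau n ≡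
        10 * (n : ℤ) * (σ 1 n : ℤ) + 25 * (n : ℤ) * (σ 7 n : ℤ) - 11 * (n : ℤ) * (σ 9 n : ℤ)
        [ZMOD 2 ^ 3 * 3 * 5 ^ 2]) ∧
    (14 * ramanujanTau n ≡
        9 * (n : ℤ) ^ 2 * (σ 1 n : ℤ) + 5 * (n : ℤ) ^ 2 * (σ 7 n : ℤ)
        [ZMOD 2 ^ 3 * 3 ^ 3 * 7]) ∧
    (5 * ramanujanTau n ≡
        8 * (n : ℤ) ^ 3 * (σ 1 n : ℤ) - 3 * (n : ℤ) ^ 3 * (σ 5 n : ℤ)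
        [ZMOD 2 ^ 5 * 3 * 5]) ∧
    (2 * ramanujanTau n ≡
        (n : ℤ) ^ 2 * (σ 1 n : ℤ) + (n : ℤ) ^ 2 * (σ 5 n : ℤ)
        [ZMOD 2 ^ 3 * 3]) := by
  refine ⟨?_, ?_, ?_, ?_, ?_, ?_, ?_, ?_⟩
  · have h := PowerSeries.coeff_modEq_of_eq_add_smul smul_ramanujanDelta_eq_add_840_smul n
    simp only [map_add, map_zsmul, PowerSeries.coeff_eulerDerivation,
      coeff_sigmaSeries, coeff_ramanujanDelta, smul_eq_mul] at h
    convert h using 1 <;> ring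
  · have h := PowerSeries.coeff_modEq_of_eq_add_smul smul_ramanujanDelta_eq_add_7200_smul n
    simp only [map_add, map_sub, map_zsmul, PowerSeries.coeff_eulerDerivation,
      coeff_sigmaSeries, coeff_ramanujanDelta, smul_eq_mul] at h
    convert h using 1 <;> ring
  · have h := PowerSeries.coeff_modEq_of_eq_add_smul smul_ramanujanDelta_eq_add_3024_smul n
    simp only [map_add, map_sub, map_zsmul, PowerSeries.coeff_eulerDerivation,
      coeff_sigmaSeries, coeff_ramanujanDelta, smul_eq_mul] at h
    convert h using 1 <;> ring
  · have h := PowerSeries.coeff_modEq_of_eq_add_smul smul_ramanujanDelta_eq_add_3360_smul n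
    simp only [map_add, map_sub, map_zsmul, PowerSeries.coeff_eulerDerivation,
      coeff_sigmaSeries, coeff_ramanujanDelta, smul_eq_mul] at h
    convert h using 1 <;> ring
  · have h := PowerSeries.coeff_modEq_of_eq_add_smul smul_ramanujanDelta_eq_add_600_smul n
    simp only [map_add, map_sub, map_zsmul, PowerSeries.coeff_eulerDerivation,
      coeff_sigmaSeries, coeff_ramanujanDelta, smul_eq_mul] at h
    convert h using 1 <;> ring
  · have h := PowerSeries.coeff_modEq_of_eq_add_smul smul_ramanujanDelta_eq_add_1512_smul n
    simp only [map_add, map_zsmul, PowerSeries.coeff_eulerDerivation,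
      coeff_sigmaSeries, coeff_ramanujanDelta, smul_eq_mul] at h
    convert h using 1 <;> ring
  · have h := PowerSeries.coeff_modEq_of_eq_add_smul smul_ramanujanDelta_eq_add_480_smul n
    simp only [map_sub, map_zsmul, PowerSeries.coeff_eulerDerivation,
      coeff_sigmaSeries, coeff_ramanujanDelta, smul_eq_mul] at h
    convert h using 1 <;> ring
  · have h := PowerSeries.coeff_modEq_of_eq_add_smul smul_ramanujanDelta_eq_add_24_smul n
    simp only [map_add, map_zsmul, PowerSeries.coeff_eulerDerivation,
      coeff_sigmaSeries, coeff_ramanujanDelta, smul_eq_mul] at h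
    convert h using 1 <;> ring
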